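/- All rings are commutative. For a ring $A$ let $\mathsf{D}^{\mathrm{b}}_{\mathrm{f}}(\mathsf{Mod}\,A)$ be the category of objects of the derived category $\mathsf{D}(\mathsf{Mod}\,A)$ with bounded cohomology and finitely generated cohomology modules. A dualizing complex over a noetherian ring $A$ is an object $R \in \mathsf{D}^{\mathrm{b}}_{\mathrm{f}}(\mathsf{Mod}\,A)$ such that (i) $R$ has finite injective dimension, i.e. there is $i_0 \in \mathbb{N}$ with $\operatorname{Ext}^i_A(M,R) = \operatorname{H}^i(\operatorname{RHom}_A(M,R)) = 0$ for all $A$-modules $M$ and all $i > i_0$; and (ii) the canonical morphism $\theta : A \to \operatorname{RHom}_A(R,R)$ is an isomorphism in $\mathsf{D}(\mathsf{Mod}\,A)$. (Here $\theta$ is the composition of the morphism $A \to \operatorname{Hom}_A(R,R)$, $a \mapsto a \cdot \mathrm{id}_R$, with the canonical morphism $\operatorname{Hom}_A(R,R) \to \operatorname{RHom}_A(R,R)$.) Proposition. Let $A$ be a noetherian ring, let $A \to B$ be a finite ring homomorphism (i.e. $B$ is a finitely generated $A$-module; so $B$ is noetherian too), and let $R_A \in \mathsf{D}^{\mathrm{b}}_{\mathrm{f}}(\mathsf{Mod}\,A)$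 be a dualizing complex over $A$. Let $R_B := \operatorname{RHom}_A(B, R_A)$, where $\operatorname{RHom}_A(B,-)$ is the right derived functor of $\operatorname{Hom}_A(B,-) : \mathsf{Mod}\,A \to \mathsf{Mod}\,B$. Then $R_B$ is a dualizing complex over $B$, and, viewed as an object of $\mathsf{D}(\mathsf{Mod}\,A)$ by restriction of scalars, it belongs to $\mathsf{D}^{\mathrm{b}}_{\mathrm{f}}(\mathsf{Mod}\,A)$. -/

import Mathlib

open CategoryTheory

universe w w' u

noncomputable section

namespace DualizingComplex

open CochainComplex CochainComplex.HomComplex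

section HomComplex

variable {A : Type u} [CommRing A]

/-- The complex of `A`-modules `Hom_A(K, L)`, for complexes of `A`-modules `K` and `L`: in degree
`n` it is `∏_p Hom_A(K^p, L^{p+n})`, and the differential is
`φ ↦ d_L ∘ φ - (-1)^n φ ∘ d_K`. -/
@[simps]
def homComplex (K L : CochainComplex (ModuleCat.{u} A) ℤ) :
    CochainComplex (ModuleCat.{u} A) ℤ where
  X n := ModuleCat.of A (Cochain K L n)
  d i j := ModuleCat.ofHom (δ_hom A K L i j)
  shape i j hij := by
    ext z : 2
    exact δ_shape i j hij z
  d_comp_d' i j k _ _ := by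
    ext z : 2
    exact δ_δ i j k z

/-- Postcomposition with a morphism of complexes `f : L ⟶ L'`, as a morphism of complexes
`Hom_A(K, L) ⟶ Hom_A(K, L')`. -/
@[simps]
def homComplexMap (K : CochainComplex (ModuleCat.{u} A) ℤ)
    {L L' : CochainComplex (ModuleCat.{u} A) ℤ} (f : L ⟶ L') :
    homComplex K L ⟶ homComplex K L' where
  f n := ModuleCat.ofHom
    { toFun := fun z : Cochain K L n => z.comp (Cochain.ofHom f) (add_zero n)
      map_add' := fun z z' => Cochain.add_comp z z' _ _
      map_smul' := fun a z => Cochain.smul_comp a z _ _ }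
  comm' i j _ := by
    ext z : 2
    exact δ_comp_ofHom z f j

/-- The functor `Hom_A(K, -)` from complexes of `A`-modules to complexes of `A`-modules. -/
@[simps]
def homFunctor (K : CochainComplex (ModuleCat.{u} A) ℤ) :
    CochainComplex (ModuleCat.{u} A) ℤ ⥤ CochainComplex (ModuleCat.{u} A) ℤ where
  obj L := homComplex K L
  map f := homComplexMap K f
  map_id L := by
    ext n z : 3
    exact Cochain.comp_id z
  map_comp f g := by
    ext n z : 3
    change Cochain.comp (z : Cochain K _ n) (Cochain.ofHom (f ≫ g)) (add_zero n) =
      Cochain.comp (Cochain.comp (z : Cochain K _ n) (Cochain.ofHom f) (add_zero n))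
        (Cochain.ofHom g) (add_zero n)
    rw [Cochain.ofHom_comp]
    exact (Cochain.comp_assoc_of_third_is_zero_cochain _ _ _ _).symm

/-- Postcomposition with a homotopy from `f` to `g`, as a linear map from `Hom_A(K, L)^i` to
`Hom_A(K, L')^j`, where `j = i - 1`. -/
def homComplexMapHomotopyAux (K : CochainComplex (ModuleCat.{u} A) ℤ)
    {L L' : CochainComplex (ModuleCat.{u} A) ℤ} {f g : L ⟶ L'} (h : Homotopy f g)
    (i j : ℤ) (hij : i + (-1) = j) : (homComplex K L).X i ⟶ (homComplex K L').X j :=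
  ModuleCat.ofHom
    { toFun := fun z : Cochain K L i => z.comp (Cochain.ofHomotopy h) hij
      map_add' := fun z z' => Cochain.add_comp z z' _ _
      map_smul' := fun a z => Cochain.smul_comp a z _ _ }

/-- A homotopy between `f` and `g` induces a homotopy between `Hom_A(K, f)` and `Hom_A(K, g)`. -/
def homComplexMapHomotopy (K : CochainComplex (ModuleCat.{u} A) ℤ)
    {L L' : CochainComplex (ModuleCat.{u} A) ℤ} {f g : L ⟶ L'} (h : Homotopy f g) :
    Homotopy (homComplexMap K f) (homComplexMap K g) where
  hom i j := if hij : i + (-1) = j then homComplexMapHomotopyAux K h i j hij else 0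
  zero i j hij := dif_neg (fun h' => hij (by simp; omega))
  comm n := by
    rw [dNext_eq _ (show (ComplexShape.up ℤ).Rel n (n + 1) by simp),
      prevD_eq _ (show (ComplexShape.up ℤ).Rel (n - 1) n by simp),
      dif_pos (by omega), dif_pos (by omega)]
    ext z : 2
    change Cochain.comp z (Cochain.ofHom f) (add_zero n) =
      Cochain.comp (δ n (n + 1) z) (Cochain.ofHomotopy h) (by omega) +
        δ (n - 1) n (Cochain.comp z (Cochain.ofHomotopy h) (by omega)) +
        Cochain.comp z (Cochain.ofHom g) (add_zero n)
    rw [δ_comp z (Cochain.ofHomotopy h) (n₁₂ := n - 1) (by omega) (n + 1) 0 n (by omega) rfl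
      (by omega), δ_ofHomotopy]
    simp
    refine Eq.trans ?_ (congrArg (· + Cochain.comp (z : Cochain K L n) (Cochain.ofHom g)
      (add_zero n)) (Cochain.comp_sub (z : Cochain K L n) (Cochain.ofHom f) (Cochain.ofHom g)
        (add_zero n)).symm)
    exact (sub_add_cancel (Cochain.comp (z : Cochain K L n) (Cochain.ofHom f) (add_zero n))
      (Cochain.comp (z : Cochain K L n) (Cochain.ofHom g) (add_zero n))).symm

/-- The functor `Hom_A(K, -)` on homotopy categories. -/
def homFunctorHomotopyCategory (K : CochainComplex (ModuleCat.{u} A) ℤ) :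
    HomotopyCategory (ModuleCat.{u} A) (ComplexShape.up ℤ) ⥤
      HomotopyCategory (ModuleCat.{u} A) (ComplexShape.up ℤ) :=
  CategoryTheory.Quotient.lift _ (homFunctor K ⋙ HomotopyCategory.quotient _ _)
    (fun _ _ _ _ ⟨h⟩ => HomotopyCategory.eq_of_homotopy _ _ (homComplexMapHomotopy K h))

/-- The morphism of complexes `A ⟶ Hom_A(K, K)` which sends `a` to the multiplication by `a`. -/
def scalarsToEnd (K : CochainComplex (ModuleCat.{u} A) ℤ) :
    (HomologicalComplex.single (ModuleCat.{u} A) (ComplexShape.up ℤ) 0).obj (ModuleCat.of A A) ⟶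
      homComplex K K :=
  HomologicalComplex.mkHomFromSingle
    (ModuleCat.ofHom ((LinearMap.toSpanSingleton A (Cochain K K 0) (Cochain.ofHom (𝟙 K)))))
    (fun n _ => by
      ext
      change δ 0 n ((1 : A) • Cochain.ofHom (𝟙 K)) = 0
      simp)

end HomComplex

section RHom

variable {A : Type u} [CommRing A] [HasDerivedCategory.{w} (ModuleCat.{u} A)]

/-- The functor `Hom_A(K, -)` on bounded below complexes up to homotopy, with values in
`D(Mod A)`. -/
def homFunctorPlus (K : CochainComplex (ModuleCat.{u} A) ℤ) :
    HomotopyCategory.Plus (ModuleCat.{u} A) ⥤ DerivedCategory (ModuleCat.{u} A) :=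
  HomotopyCategory.Plus.ι (ModuleCat.{u} A) ⋙ homFunctorHomotopyCategory K ⋙ DerivedCategory.Qh

/-- `RHom_A(K, -) : D⁺(Mod A) ⥤ D(Mod A)`, the right derived functor of `Hom_A(K, -)`. -/
def rHom (K : CochainComplex (ModuleCat.{u} A) ℤ) :
    DerivedCategory.Plus (ModuleCat.{u} A) ⥤ DerivedCategory (ModuleCat.{u} A) :=
  (homFunctorPlus K).totalRightDerived DerivedCategory.Plus.Qh
    (HomotopyCategory.Plus.quasiIso (ModuleCat.{u} A))

/-- The canonical morphism `η : Hom_A(K, L) ⟶ RHom_A(K, L)`, which is part of the data of the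
right derived functor. -/
def rHomUnit (K : CochainComplex (ModuleCat.{u} A) ℤ) :
    homFunctorPlus K ⟶ DerivedCategory.Plus.Qh ⋙ rHom K :=
  (homFunctorPlus K).totalRightDerivedUnit DerivedCategory.Plus.Qh
    (HomotopyCategory.Plus.quasiIso (ModuleCat.{u} A))

/-- `Ext^i_A(M, N) = H^i(RHom_A(M, N))` for an `A`-module `M` and `N` in `D⁺(Mod A)`. -/
def ext (M : ModuleCat.{u} A) (N : DerivedCategory.Plus (ModuleCat.{u} A)) (i : ℤ) :
    ModuleCat.{u} A :=
  (DerivedCategory.homologyFunctor (ModuleCat.{u} A) i).obj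
    ((rHom ((HomologicalComplex.single (ModuleCat.{u} A) (ComplexShape.up ℤ) 0).obj M)).obj N)

/-- The canonical morphism `θ : A ⟶ RHom_A(K, K)` in `D(Mod A)`, for a bounded below complex `K`:
the composition of `A ⟶ Hom_A(K, K)` and `η : Hom_A(K, K) ⟶ RHom_A(K, K)`. -/
def theta (K : CochainComplex.Plus (ModuleCat.{u} A)) :
    DerivedCategory.Qh.obj ((HomotopyCategory.quotient _ _).obj
      ((HomologicalComplex.single (ModuleCat.{u} A) (ComplexShape.up ℤ) 0).obj
        (ModuleCat.of A A))) ⟶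
      (rHom K.obj).obj (DerivedCategory.Plus.Q.obj K) :=
  DerivedCategory.Qh.map ((HomotopyCategory.quotient _ _).map (scalarsToEnd K.obj)) ≫
    (rHomUnit K.obj).app ((HomotopyCategory.Plus.quotient _).obj K)

/-- The objects of `D^b_f(Mod A)`: the objects of `D(Mod A)` with bounded and finitely generated
cohomology. -/
structure IsBoundedFinite (X : DerivedCategory (ModuleCat.{u} A)) : Prop where
  bounded : ∃ a b : ℤ, X.IsGE a ∧ X.IsLE b
  finite (i : ℤ) :
    Module.Finite A ((DerivedCategory.homologyFunctor (ModuleCat.{u} A) i).obj X)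

/-- `N` has finite injective dimension: there is a natural number `i₀` such that
`Ext^i_A(M, N) = 0` for all `A`-modules `M` and all `i > i₀`. -/
def HasFiniteInjectiveDimension (N : DerivedCategory.Plus (ModuleCat.{u} A)) : Prop :=
  ∃ i₀ : ℕ, ∀ (M : ModuleCat.{u} A) (i : ℤ), (i₀ : ℤ) < i → Subsingleton (ext M N i)

/-- `R` is a dualizing complex over `A`. An object of the localization `D⁺(Mod A)` is only
isomorphic to (the image of) a complex; the condition that `θ : A ⟶ RHom_A(R, R)` is an
isomorphism is stated for a bounded below complex `K` that represents `R`, and it does not depend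
on the choice of `K`. -/
structure IsDualizing (R : DerivedCategory.Plus (ModuleCat.{u} A)) : Prop where
  isBoundedFinite : IsBoundedFinite (DerivedCategory.Plus.ι.obj R)
  hasFiniteInjectiveDimension : HasFiniteInjectiveDimension R
  isIso_theta : ∃ K : CochainComplex.Plus (ModuleCat.{u} A),
    Nonempty (DerivedCategory.Plus.Q.obj K ≅ R) ∧ IsIso (theta K)

end RHom

section ChangeOfRings

variable {A B : Type u} [CommRing A] [CommRing B] (f : A →+* B)

instance : (ModuleCat.coextendScalars.{u, u, u} f).Additive where

variable [HasDerivedCategory.{w} (ModuleCat.{u} A)] [HasDerivedCategory.{w'} (ModuleCat.{u} B)]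

/-- `RHom_A(B, -) : D⁺(Mod A) ⥤ D⁺(Mod B)`, the right derived functor of the functor
`Hom_A(B, -) : Mod A ⥤ Mod B`. -/
def rHomRing : DerivedCategory.Plus (ModuleCat.{u} A) ⥤ DerivedCategory.Plus (ModuleCat.{u} B) :=
  (ModuleCat.coextendScalars.{u, u, u} f).rightDerivedFunctorPlus

/-- Restriction of scalars `D(Mod B) ⥤ D(Mod A)`. -/
def restrictScalarsDerived :
    DerivedCategory (ModuleCat.{u} B) ⥤ DerivedCategory (ModuleCat.{u} A) :=
  (ModuleCat.restrictScalars.{u, u, u} f).mapDerivedCategory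

end ChangeOfRings

end DualizingComplex

end

/-! Represent `R` by a bounded complex `T` of injective `A`-modules such that `A ⟶ Hom_A(T, T)` is a
quasi-isomorphism (`IsDualizing.exists_bounded_injective`): take an injective resolution and
truncate it, finite injective dimension ensuring that the truncation still consists of injectives.
Then `RHom_A(B, R)` is `Hom_A(B, T)`, a bounded complex of injective `B`-modules, because
coextension of scalars is right adjoint to an exact functor. This settles boundedness and finite
injective dimension; finiteness of the cohomology is a dimension shift along presentations
(`finite_homology_dualComplex`).

The core is `θ`. By adjunction the endomorphism complex of `Hom_A(B, T)` over `B` is `Hom_A(Hom_A(B,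
T), T)`, the double dual of the `A`-module `B`, and multiplication by scalars becomes the biduality
map (`restrict_scalarsToEnd`). It therefore suffices that biduality is a quasi-isomorphism for every
finitely generated `M` (`quasiIso_toBidual`). For `M = A` this is the hypothesis on `T`, and the
five lemma gives finite free modules. The general case is a descending induction on the degree along
`0 ⟶ N ⟶ A^r ⟶ M ⟶ 0`: `N` is finitely generated since `A` is noetherian, and all double duals
vanish above a common degree since `T` is bounded. -/

namespace HomologicalComplex.HomologySequence

/-! ### Four lemmas for the middle term of a morphism of short exact sequences of complexes. -/

open ComposableArrows Abelian

variable {C ι : Type*} [Category* C] [Abelian C] {c : ComplexShape ι}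
  {S₁ S₂ : ShortComplex (HomologicalComplex C c)} (φ : S₁ ⟶ S₂)
  (hS₁ : S₁.ShortExact) (hS₂ : S₂.ShortExact)

include hS₁ hS₂

/-- The four lemma on the last four terms of the six-term homology sequence, starting at `H_i` of
the third complex. With its epi counterpart it handles `A^(n+1)` as an extension of `A^n` by `A`. -/
lemma mono_homologyMap_τ₂ (i j : ι) (hij : c.Rel i j)
    (h₁ : Epi (homologyMap φ.τ₃ i)) (h₂ : Mono (homologyMap φ.τ₁ j))
    (h₃ : Mono (homologyMap φ.τ₃ j)) :
    Mono (homologyMap φ.τ₂ j) := by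
  apply mono_of_epi_of_mono_of_mono
    ((δ₀Functor ⋙ δ₀Functor).map (mapComposableArrows₅ φ hS₁ hS₂ i j hij))
  · exact (composableArrows₅_exact hS₁ i j hij).δ₀.δ₀
  · exact (composableArrows₅_exact hS₂ i j hij).δ₀.δ₀
  · exact h₁
  · exact h₂
  · exact h₃

lemma epi_homologyMap_τ₂ (i j : ι) (hij : c.Rel i j)
    (h₁ : Epi (homologyMap φ.τ₁ i)) (h₂ : Epi (homologyMap φ.τ₃ i))
    (h₃ : Mono (homologyMap φ.τ₁ j)) :
    Epi (homologyMap φ.τ₂ i) := by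
  apply epi_of_epi_of_epi_of_mono
    ((δlastFunctor ⋙ δlastFunctor).map (mapComposableArrows₅ φ hS₁ hS₂ i j hij))
  · exact (composableArrows₅_exact hS₁ i j hij).δlast.δlast
  · exact (composableArrows₅_exact hS₂ i j hij).δlast.δlast
  · exact h₁
  · exact h₂
  · exact h₃

end HomologicalComplex.HomologySequence

namespace DualizingComplex

open CochainComplex CochainComplex.HomComplex HomologicalComplex

noncomputable section

/-! ### Contravariance of the Hom complex and its exactness on injectives. -/

section Precomposition

variable {A : Type u} [CommRing A]

/-- Precomposition with a morphism of complexes `g : K' ⟶ K`, as a morphism of complexes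
`Hom_A(K, L) ⟶ Hom_A(K', L)`. -/
def homComplexPrecomp {K K' : CochainComplex (ModuleCat.{u} A) ℤ} (g : K' ⟶ K)
    (L : CochainComplex (ModuleCat.{u} A) ℤ) : homComplex K L ⟶ homComplex K' L where
  f n := ModuleCat.ofHom
    { toFun := fun z : Cochain K L n => (Cochain.ofHom g).comp z (zero_add n)
      map_add' := fun z z' => Cochain.comp_add _ z z' _
      map_smul' := fun a z => Cochain.comp_smul _ a z _ }
  comm' i j _ := by
    ext z : 2
    exact δ_ofHom_comp g z j

lemma homComplexPrecomp_comp {K K' K'' : CochainComplex (ModuleCat.{u} A) ℤ} (h : K'' ⟶ K')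
    (g : K' ⟶ K) (L : CochainComplex (ModuleCat.{u} A) ℤ) :
    homComplexPrecomp (h ≫ g) L = homComplexPrecomp g L ≫ homComplexPrecomp h L := by
  ext n z : 3
  change Cochain.comp (Cochain.ofHom (h ≫ g)) (z : Cochain K L n) (zero_add n) =
    Cochain.comp (Cochain.ofHom h)
      (Cochain.comp (Cochain.ofHom g) (z : Cochain K L n) (zero_add n)) (zero_add n)
  rw [Cochain.ofHom_comp]
  exact Cochain.comp_assoc_of_first_is_zero_cochain _ _ _ _

lemma homComplexPrecomp_id (K L : CochainComplex (ModuleCat.{u} A) ℤ) :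
    homComplexPrecomp (𝟙 K) L = 𝟙 _ := by
  ext n z : 3
  exact Cochain.id_comp (z : Cochain K L n)

lemma homComplexPrecomp_zero (K K' L : CochainComplex (ModuleCat.{u} A) ℤ) :
    homComplexPrecomp (0 : K' ⟶ K) L = 0 := by
  ext n z : 3
  change Cochain.comp (Cochain.ofHom 0) (z : Cochain K L n) (zero_add n) = 0
  rw [Cochain.ofHom_zero]
  exact Cochain.zero_comp _ _

/-- The isomorphism `Hom_A(K, L) ≅ Hom_A(K', L)` induced by an isomorphism `K' ≅ K`. -/
def homComplexPrecompIso {K K' : CochainComplex (ModuleCat.{u} A) ℤ} (e : K' ≅ K)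
    (L : CochainComplex (ModuleCat.{u} A) ℤ) : homComplex K L ≅ homComplex K' L where
  hom := homComplexPrecomp e.hom L
  inv := homComplexPrecomp e.inv L
  hom_inv_id := by rw [← homComplexPrecomp_comp, e.inv_hom_id, homComplexPrecomp_id]
  inv_hom_id := by rw [← homComplexPrecomp_comp, e.hom_inv_id, homComplexPrecomp_id]

/-- The short complex `Hom_A(S₃, L) ⟶ Hom_A(S₂, L) ⟶ Hom_A(S₁, L)`. -/
@[simps]
def homComplexShortComplex (S : ShortComplex (CochainComplex (ModuleCat.{u} A) ℤ))
    (L : CochainComplex (ModuleCat.{u} A) ℤ) :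
    ShortComplex (CochainComplex (ModuleCat.{u} A) ℤ) where
  X₁ := homComplex S.X₃ L
  X₂ := homComplex S.X₂ L
  X₃ := homComplex S.X₁ L
  f := homComplexPrecomp S.g L
  g := homComplexPrecomp S.f L
  zero := by rw [← homComplexPrecomp_comp, S.zero, homComplexPrecomp_zero]

/-- In degree `n` this is a product over `p` of the sequences `Hom(-, L^(p+n))`. Injectivity of the
terms of `L` enters only in extending components along the monomorphism `S.f`. -/
lemma homComplexShortComplex_shortExact
    {S : ShortComplex (CochainComplex (ModuleCat.{u} A) ℤ)} (hS : S.ShortExact)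
    (L : CochainComplex (ModuleCat.{u} A) ℤ) [∀ n, Injective (L.X n)] :
    (homComplexShortComplex S L).ShortExact := by
  have hS' (p : ℤ) : (S.map (eval _ _ p)).ShortExact := hS.map_of_exact _
  refine shortExact_of_degreewise_shortExact _ fun n => ?_
  refine ShortComplex.ShortExact.mk' ?_ ?_ ?_
  · rw [ShortComplex.moduleCat_exact_iff]
    intro (z : Cochain S.X₂ L n) (hz : (Cochain.ofHom S.f).comp z (zero_add n) = 0)
    have hz' (p q : ℤ) (hpq : p + n = q) : S.f.f p ≫ z.v p q hpq = 0 := by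
      have := Cochain.congr_v hz p q hpq
      simpa using this
    have (p : ℤ) : Epi (S.map (eval _ _ p)).g := (hS' p).epi_g
    refine ⟨(Cochain.mk fun p q hpq => (hS' p).exact.desc (z.v p q hpq) (hz' p q hpq) :
      Cochain S.X₃ L n), ?_⟩
    change Cochain.comp (Cochain.ofHom S.g) _ (zero_add n) = z
    ext p q hpq : 1
    simp only [Cochain.zero_cochain_comp_v, Cochain.ofHom_v]
    exact (hS' p).exact.g_desc _ _
  · rw [ModuleCat.mono_iff_injective, injective_iff_map_eq_zero]
    intro (z : Cochain S.X₃ L n) (hz : (Cochain.ofHom S.g).comp z (zero_add n) = 0)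
    change z = 0
    ext p q hpq : 1
    have : Epi (S.g.f p) := (hS' p).epi_g
    rw [← cancel_epi (S.g.f p)]
    have := Cochain.congr_v hz p q hpq
    simpa using this
  · rw [ModuleCat.epi_iff_surjective]
    intro (z : Cochain S.X₁ L n)
    have (p : ℤ) : Mono (S.f.f p) := (hS' p).mono_f
    refine ⟨(Cochain.mk fun p q hpq => Injective.factorThru (z.v p q hpq) (S.f.f p) :
      Cochain S.X₂ L n), ?_⟩
    change Cochain.comp (Cochain.ofHom S.f) _ (zero_add n) = z
    ext p q hpq : 1
    simp only [Cochain.zero_cochain_comp_v, Cochain.ofHom_v, Cochain.mk_v]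
    exact Injective.comp_factorThru _ _

lemma homComplex_exactAt_iff (K L : CochainComplex (ModuleCat.{u} A) ℤ) (n : ℤ) :
    (homComplex K L).ExactAt n ↔ ∀ z : Cochain K L n, δ n (n + 1) z = 0 →
      ∃ y : Cochain K L (n - 1), δ (n - 1) n y = z := by
  rw [exactAt_iff' _ (n - 1) n (n + 1) (by simp) (by simp), ShortComplex.moduleCat_exact_iff]
  rfl

lemma homComplex_acyclic {K L : CochainComplex (ModuleCat.{u} A) ℤ} (hK : K.Acyclic)
    [L.IsKInjective] : (homComplex K L).Acyclic := fun n => by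
  rw [homComplex_exactAt_iff]
  intro z hz
  exact IsKInjective.eq_δ_of_cocycle ⟨z, (Cocycle.mem_iff n (n + 1) rfl z).2 hz⟩ hK
    (n - 1) (by simp)

/-- As `g` is a monomorphism, its cokernel gives a short exact sequence of Hom complexes, whose
kernel term `Hom(coker g, L)` is acyclic because `L` is K-injective. -/
lemma quasiIso_homComplexPrecomp {K K' : CochainComplex (ModuleCat.{u} A) ℤ} (g : K' ⟶ K)
    [Mono g] [QuasiIso g] (L : CochainComplex (ModuleCat.{u} A) ℤ) [∀ n, Injective (L.X n)]
    [L.IsKInjective] : QuasiIso (homComplexPrecomp g L) := by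
  let S : ShortComplex (CochainComplex (ModuleCat.{u} A) ℤ) :=
    ShortComplex.mk g (Limits.cokernel.π g) (by simp)
  have hS : S.ShortExact :=
    ShortComplex.ShortExact.mk' (ShortComplex.exact_cokernel g) inferInstance inferInstance
  have hK : S.X₃.Acyclic := hS.acyclic_X₃ ‹_›
  have hS' := homComplexShortComplex_shortExact hS L
  have h : (homComplexShortComplex S L).X₁.Acyclic := homComplex_acyclic hK
  rw [quasiIso_iff]
  intro n
  rw [quasiIsoAt_iff_isIso_homologyMap]
  have hn := (h n).isZero_homology
  have hn' := (h (n + 1)).isZero_homology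
  have : Mono (homologyMap (homComplexShortComplex S L).g n) :=
    (hS'.homology_exact₂ n).mono_g (hn.eq_of_src _ _)
  have : Epi (homologyMap (homComplexShortComplex S L).g n) :=
    (hS'.homology_exact₃ n (n + 1) (by simp)).epi_f (hn'.eq_of_tgt _ _)
  exact isIso_of_mono_of_epi (homologyMap (homComplexShortComplex S L).g n)

/-- A quasi-isomorphism between K-injective complexes is a homotopy equivalence, and `Hom(K, -)`
preserves homotopies. -/
lemma quasiIso_homComplexMap (K : CochainComplex (ModuleCat.{u} A) ℤ)
    {L L' : CochainComplex (ModuleCat.{u} A) ℤ} [L.IsKInjective] [L'.IsKInjective] (g : L ⟶ L')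
    [QuasiIso g] : QuasiIso (homComplexMap K g) := by
  apply homotopyEquivalences_le_quasiIso
  rw [← isIso_quotient_map_iff_homotopyEquivalences]
  have := (isIso_quotient_map_iff_homotopyEquivalences g).2
    ((IsKInjective.quasiIso_iff g).1 inferInstance)
  exact inferInstanceAs (IsIso ((homFunctorHomotopyCategory K).map
    ((HomotopyCategory.quotient _ _).map g)))

lemma scalarsToEnd_f_apply (K : CochainComplex (ModuleCat.{u} A) ℤ) (a : A) :
    (scalarsToEnd K).f 0 ((singleObjXSelf (ComplexShape.up ℤ) 0 (ModuleCat.of A A)).inv a) =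
      a • Cochain.ofHom (𝟙 K) := by
  simp [scalarsToEnd]
  rfl

/-- Two morphisms of complexes from `M` in degree `0` are equal if they agree on the elements
of `M`. -/
lemma single_hom_ext {M : ModuleCat.{u} A} {L : CochainComplex (ModuleCat.{u} A) ℤ}
    {φ ψ : (single (ModuleCat.{u} A) (ComplexShape.up ℤ) 0).obj M ⟶ L}
    (h : ∀ m : M, φ.f 0 ((singleObjXSelf (ComplexShape.up ℤ) 0 M).inv m) =
      ψ.f 0 ((singleObjXSelf (ComplexShape.up ℤ) 0 M).inv m)) : φ = ψ := by
  apply from_single_hom_ext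
  rw [← cancel_epi (singleObjXSelf (ComplexShape.up ℤ) 0 M).inv]
  ext m
  exact h m

/-- Both sides send `a` to `a • g`. Since `Hom(K, K)` is not functorial in `K`, the condition on
scalars is carried from `K` to `L` and back through `Hom(K, L)`. -/
lemma scalarsToEnd_comp {K L : CochainComplex (ModuleCat.{u} A) ℤ} (g : K ⟶ L) :
    scalarsToEnd K ≫ homComplexMap K g = scalarsToEnd L ≫ homComplexPrecomp g L := by
  apply single_hom_ext
  intro a
  refine (congrArg ((homComplexMap K g).f 0) (scalarsToEnd_f_apply K a)).trans
    (Eq.trans ?_ (congrArg ((homComplexPrecomp g L).f 0) (scalarsToEnd_f_apply L a)).symm)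
  change (a • Cochain.ofHom (𝟙 K)).comp (Cochain.ofHom g) (add_zero 0) =
    (Cochain.ofHom g).comp (a • Cochain.ofHom (𝟙 L)) (zero_add 0)
  simp [← Cochain.ofHom_comp]

end Precomposition

/-! ### Biduality with respect to a complex of injectives. -/

section Biduality

variable {A : Type u} [CommRing A]

/-- The complex `Hom_A(M, I)` for a module `M` and a complex `I`, which is `Hom_A(M, I^n)` in
degree `n`. -/
@[simps]
def dualComplex (M : ModuleCat.{u} A) (I : CochainComplex (ModuleCat.{u} A) ℤ) :
    CochainComplex (ModuleCat.{u} A) ℤ where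
  X n := ModuleCat.of A (M ⟶ I.X n)
  d i j := ModuleCat.ofHom (Linear.rightComp A M (I.d i j))
  shape i j hij := by
    ext φ : 2
    simp [I.shape i j hij]
  d_comp_d' i j k _ _ := by
    ext φ : 2
    simp

/-- The morphism `Hom_A(N, I) ⟶ Hom_A(M, I)` induced by a linear map `M ⟶ N`. -/
@[simps]
def dualComplexMap {M N : ModuleCat.{u} A} (g : M ⟶ N)
    (I : CochainComplex (ModuleCat.{u} A) ℤ) : dualComplex N I ⟶ dualComplex M I where
  f n := ModuleCat.ofHom (Linear.leftComp A (I.X n) g)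
  comm' i j _ := by
    ext φ : 2
    exact Category.assoc g (show N ⟶ I.X i from φ) (I.d i j)

/-- The short complex `Hom_A(S₃, I) ⟶ Hom_A(S₂, I) ⟶ Hom_A(S₁, I)`. -/
@[simps]
def dualShortComplex (S : ShortComplex (ModuleCat.{u} A))
    (I : CochainComplex (ModuleCat.{u} A) ℤ) :
    ShortComplex (CochainComplex (ModuleCat.{u} A) ℤ) where
  X₁ := dualComplex S.X₃ I
  X₂ := dualComplex S.X₂ I
  X₃ := dualComplex S.X₁ I
  f := dualComplexMap S.g I
  g := dualComplexMap S.f I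
  zero := by
    ext n φ : 3
    change S.f ≫ S.g ≫ (show S.X₃ ⟶ I.X n from φ) = 0
    rw [S.zero_assoc, Limits.zero_comp]

lemma dualShortComplex_shortExact {S : ShortComplex (ModuleCat.{u} A)} (hS : S.ShortExact)
    (I : CochainComplex (ModuleCat.{u} A) ℤ) [∀ n, Injective (I.X n)] :
    (dualShortComplex S I).ShortExact := by
  have := hS.mono_f
  have := hS.epi_g
  refine shortExact_of_degreewise_shortExact _ fun n => ?_
  refine ShortComplex.ShortExact.mk' ?_ ?_ ?_
  · rw [ShortComplex.moduleCat_exact_iff]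
    intro (φ : S.X₂ ⟶ I.X n) (hφ : S.f ≫ φ = 0)
    exact ⟨hS.exact.desc φ hφ, hS.exact.g_desc φ hφ⟩
  · rw [ModuleCat.mono_iff_injective, injective_iff_map_eq_zero]
    intro (φ : S.X₃ ⟶ I.X n) (hφ : S.g ≫ φ = 0)
    exact (cancel_epi S.g).1 (hφ.trans Limits.comp_zero.symm)
  · rw [ModuleCat.epi_iff_surjective]
    intro (φ : S.X₁ ⟶ I.X n)
    exact ⟨(Injective.factorThru φ S.f : S.X₂ ⟶ I.X n),
      (Injective.comp_factorThru φ S.f : S.f ≫ Injective.factorThru φ S.f = φ)⟩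

/-- Evaluation at `m : M`, as a morphism of complexes `Hom_A(M, I) ⟶ I`. -/
def dualEval {M : ModuleCat.{u} A} (I : CochainComplex (ModuleCat.{u} A) ℤ) (m : M) :
    dualComplex M I ⟶ I where
  f n := ModuleCat.ofHom
    { toFun := fun φ : M ⟶ I.X n => φ m
      map_add' := fun _ _ => rfl
      map_smul' := fun _ _ => rfl }
  comm' _ _ _ := rfl

/-- The double dual `Hom_A(Hom_A(M, I), I)`. -/
abbrev bidualComplex (M : ModuleCat.{u} A) (I : CochainComplex (ModuleCat.{u} A) ℤ) :
    CochainComplex (ModuleCat.{u} A) ℤ :=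
  homComplex (dualComplex M I) I

/-- The linear map from `M` to the cochains of degree zero of its double dual. -/
def bidualLinearMap (M : ModuleCat.{u} A) (I : CochainComplex (ModuleCat.{u} A) ℤ) :
    M →ₗ[A] Cochain (dualComplex M I) I 0 where
  toFun m := Cochain.ofHom (dualEval I m)
  map_add' m m' := by
    ext p φ : 3
    simp only [Cochain.ofHom_v, Cochain.add_v]
    exact map_add (ModuleCat.Hom.hom (show M ⟶ I.X p from φ)) m m'
  map_smul' a m := by
    ext p φ : 3
    simp only [Cochain.ofHom_v, Cochain.smul_v]
    exact map_smul (ModuleCat.Hom.hom (show M ⟶ I.X p from φ)) a m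

/-- The biduality morphism `M ⟶ Hom_A(Hom_A(M, I), I)`. -/
def toBidual (M : ModuleCat.{u} A) (I : CochainComplex (ModuleCat.{u} A) ℤ) :
    (single (ModuleCat.{u} A) (ComplexShape.up ℤ) 0).obj M ⟶ bidualComplex M I :=
  mkHomFromSingle (ModuleCat.ofHom (bidualLinearMap M I)) (fun n _ => by
    ext m
    exact δ_ofHom (dualEval I m))

lemma toBidual_f_apply (M : ModuleCat.{u} A) (I : CochainComplex (ModuleCat.{u} A) ℤ) (m : M) :
    (toBidual M I).f 0 ((singleObjXSelf (ComplexShape.up ℤ) 0 M).inv m) =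
      Cochain.ofHom (dualEval I m) := by
  simp [toBidual]
  rfl

lemma toBidual_naturality {M N : ModuleCat.{u} A} (g : M ⟶ N)
    (I : CochainComplex (ModuleCat.{u} A) ℤ) :
    (single (ModuleCat.{u} A) (ComplexShape.up ℤ) 0).map g ≫ toBidual N I =
      toBidual M I ≫ homComplexPrecomp (dualComplexMap g I) I := by
  apply single_hom_ext
  intro m
  have h : ((single (ModuleCat.{u} A) (ComplexShape.up ℤ) 0).map g).f 0
      ((singleObjXSelf (ComplexShape.up ℤ) 0 M).inv m) =
        (singleObjXSelf (ComplexShape.up ℤ) 0 N).inv (g m) := by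
    rw [single_map_f_self]
    simp
  refine ((congrArg ((toBidual N I).f 0) h).trans (toBidual_f_apply N I (g m))).trans
    (Eq.trans ?_
      (congrArg ((homComplexPrecomp (dualComplexMap g I) I).f 0) (toBidual_f_apply M I m)).symm)
  exact Cochain.ofHom_comp (dualComplexMap g I) (dualEval I m)

/-- The morphism of short complexes given by biduality. -/
@[simps]
def toBidualShortComplex (S : ShortComplex (ModuleCat.{u} A))
    (I : CochainComplex (ModuleCat.{u} A) ℤ) :
    S.map (single (ModuleCat.{u} A) (ComplexShape.up ℤ) 0) ⟶
      homComplexShortComplex (dualShortComplex S I) I where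
  τ₁ := toBidual S.X₁ I
  τ₂ := toBidual S.X₂ I
  τ₃ := toBidual S.X₃ I
  comm₁₂ := (toBidual_naturality S.f I).symm
  comm₂₃ := (toBidual_naturality S.g I).symm

/-- The isomorphism `Hom_A(A, I) ≅ I`. -/
def dualComplexSelfIso (I : CochainComplex (ModuleCat.{u} A) ℤ) :
    dualComplex (ModuleCat.of A A) I ≅ I :=
  have (n : ℤ) : IsIso ((dualEval (M := ModuleCat.of A A) I (1 : A)).f n) := by
    rw [ConcreteCategory.isIso_iff_bijective]
    refine ⟨?_, fun x => ⟨ModuleCat.ofHom (LinearMap.toSpanSingleton A (I.X n) x), ?_⟩⟩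
    · intro (φ : ModuleCat.of A A ⟶ I.X n) (ψ : ModuleCat.of A A ⟶ I.X n) h
      change φ = ψ
      ext
      exact h
    · exact one_smul A x
  have : IsIso (dualEval (M := ModuleCat.of A A) I (1 : A)) := Hom.isIso_of_components _
  asIso (dualEval (M := ModuleCat.of A A) I (1 : A))

lemma dualComplexSelfIso_hom (I : CochainComplex (ModuleCat.{u} A) ℤ) :
    (dualComplexSelfIso I).hom = dualEval (M := ModuleCat.of A A) I (1 : A) := rfl

/-- Evaluation at `a` is `a` times evaluation at `1`. This is how the hypothesis on `θ` becomes
biduality for `A`, the starting point of the dévissage. -/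
lemma scalarsToEnd_comp_dualComplexSelfIso (I : CochainComplex (ModuleCat.{u} A) ℤ) :
    scalarsToEnd I ≫ (homComplexPrecompIso (dualComplexSelfIso I) I).hom =
      toBidual (ModuleCat.of A A) I := by
  apply single_hom_ext
  intro (a : A)
  refine (congrArg ((homComplexPrecompIso (dualComplexSelfIso I) I).hom.f 0)
    (scalarsToEnd_f_apply I a)).trans (Eq.trans ?_ (toBidual_f_apply _ I _).symm)
  change (Cochain.ofHom (dualComplexSelfIso I).hom).comp (a • Cochain.ofHom (𝟙 I)) (zero_add 0) =
    _
  ext p φ : 3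
  simp only [dualComplexSelfIso_hom, Cochain.zero_cochain_comp_v, Cochain.ofHom_v, Cochain.smul_v]
  exact ((map_smul (ModuleCat.Hom.hom (show ModuleCat.of A A ⟶ I.X p from φ)) a (1 : A)).symm).trans
    (congrArg (ModuleCat.Hom.hom (show ModuleCat.of A A ⟶ I.X p from φ)) (mul_one a))

variable {I : CochainComplex (ModuleCat.{u} A) ℤ}

lemma quasiIso_toBidual_self [QuasiIso (scalarsToEnd I)] :
    QuasiIso (toBidual (ModuleCat.of A A) I) := by
  rw [← scalarsToEnd_comp_dualComplexSelfIso]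
  infer_instance

/-- The short exact sequence `0 ⟶ A ⟶ A^(n+1) ⟶ A^n ⟶ 0`. -/
@[simps]
def finSuccShortComplex (A : Type u) [CommRing A] (n : ℕ) : ShortComplex (ModuleCat.{u} A) where
  X₁ := ModuleCat.of A A
  X₂ := ModuleCat.of A (Fin (n + 1) → A)
  X₃ := ModuleCat.of A (Fin n → A)
  f := ModuleCat.ofHom (LinearMap.single A (fun _ => A) 0)
  g := ModuleCat.ofHom (LinearMap.funLeft A A Fin.succ)
  zero := by
    ext : 1
    apply LinearMap.ext
    intro a
    funext i
    simp [LinearMap.funLeft]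
    rfl

lemma finSuccShortComplex_shortExact (n : ℕ) : (finSuccShortComplex A n).ShortExact := by
  refine ShortComplex.ShortExact.mk' ?_ ?_ ?_
  · rw [ShortComplex.moduleCat_exact_iff]
    intro (x : Fin (n + 1) → A) hx
    refine ⟨x 0, funext fun i => ?_⟩
    refine Fin.cases ?_ (fun i => ?_) i
    · exact Pi.single_eq_same (M := fun _ : Fin (n + 1) => A) 0 (x 0)
    · exact (Pi.single_eq_of_ne (M := fun _ : Fin (n + 1) => A) (Fin.succ_ne_zero i) (x 0)).trans
        (congrFun hx i).symm
  · rw [ModuleCat.mono_iff_injective]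
    exact Pi.single_injective (M := fun _ : Fin (n + 1) => A) 0
  · rw [ModuleCat.epi_iff_surjective]
    exact LinearMap.funLeft_surjective_of_injective A A _ (Fin.succ_injective n)

/-- A finitely generated module is the cokernel of a monomorphism into a finite free module. -/
lemma exists_shortExact_of_finite (M : ModuleCat.{u} A) [Module.Finite A M] :
    ∃ (n : ℕ) (N : ModuleCat.{u} A) (f : N ⟶ ModuleCat.of A (Fin n → A))
      (g : ModuleCat.of A (Fin n → A) ⟶ M) (w : f ≫ g = 0),
      (ShortComplex.mk f g w).ShortExact := by
  obtain ⟨n, g, hg⟩ := Module.Finite.exists_fin' A M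
  refine ⟨n, ModuleCat.of A (LinearMap.ker g), ModuleCat.ofHom (LinearMap.ker g).subtype,
    ModuleCat.ofHom g, ?_, ShortComplex.ShortExact.mk' ?_ ?_ ?_⟩
  · ext x
    exact x.2
  · rw [ShortComplex.moduleCat_exact_iff]
    exact fun x hx => ⟨⟨x, hx⟩, rfl⟩
  · rw [ModuleCat.mono_iff_injective]
    exact Subtype.val_injective
  · rw [ModuleCat.epi_iff_surjective]
    exact hg

variable [∀ n, Injective (I.X n)]

lemma shortExact_map_single {S : ShortComplex (ModuleCat.{u} A)} (hS : S.ShortExact) :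
    (S.map (single (ModuleCat.{u} A) (ComplexShape.up ℤ) 0)).ShortExact :=
  hS.map_of_exact _

lemma bidualShortComplex_shortExact {S : ShortComplex (ModuleCat.{u} A)} (hS : S.ShortExact) :
    (homComplexShortComplex (dualShortComplex S I) I).ShortExact :=
  homComplexShortComplex_shortExact (dualShortComplex_shortExact hS I) I

open HomologySequence in
-- The five lemma along `0 ⟶ A ⟶ A^(n+1) ⟶ A^n ⟶ 0`. Neither boundedness of `I` nor noetherianity is
-- needed yet.
lemma quasiIso_toBidual_fin [QuasiIso (scalarsToEnd I)] (n : ℕ) :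
    QuasiIso (toBidual (ModuleCat.of A (Fin n → A)) I) := by
  induction n with
  | zero =>
    have h : Limits.IsZero (ModuleCat.of A (Fin 0 → A)) :=
      ModuleCat.isZero_of_subsingleton _
    have h₁ : Limits.IsZero ((single (ModuleCat.{u} A) (ComplexShape.up ℤ) 0).obj
      (ModuleCat.of A (Fin 0 → A))) := Functor.map_isZero _ h
    have h₂ : Limits.IsZero (bidualComplex (ModuleCat.of A (Fin 0 → A)) I) := by
      rw [Limits.IsZero.iff_id_eq_zero]
      ext p z : 3
      refine Cochain.ext _ _ fun q r hqr => ?_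
      ext φ
      have hφ : φ = 0 := h.eq_of_src _ _
      rw [hφ, map_zero, map_zero]
    have : IsIso (toBidual (ModuleCat.of A (Fin 0 → A)) I) :=
      ⟨0, h₁.eq_of_src _ _, h₂.eq_of_src _ _⟩
    infer_instance
  | succ n ih =>
    have hA : QuasiIso (toBidualShortComplex (finSuccShortComplex A n) I).τ₁ :=
      quasiIso_toBidual_self
    have hF : QuasiIso (toBidualShortComplex (finSuccShortComplex A n) I).τ₃ := ih
    have hS := finSuccShortComplex_shortExact (A := A) n
    rw [quasiIso_iff]
    intro i
    rw [quasiIsoAt_iff_isIso_homologyMap]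
    have := mono_homologyMap_τ₂ (toBidualShortComplex (finSuccShortComplex A n) I)
      (shortExact_map_single hS) (bidualShortComplex_shortExact hS) (i - 1) i (by simp)
      inferInstance inferInstance inferInstance
    have := epi_homologyMap_τ₂ (toBidualShortComplex (finSuccShortComplex A n) I)
      (shortExact_map_single hS) (bidualShortComplex_shortExact hS) i (i + 1) (by simp)
      inferInstance inferInstance inferInstance
    exact isIso_of_mono_of_epi
      (homologyMap (toBidualShortComplex (finSuccShortComplex A n) I).τ₂ i)

/-- If a property of integers holds for all sufficiently large integers and holds for `n` as soon
as it holds for `n + 1`, then it holds for all integers. -/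
lemma int_descending_induction {P : ℤ → Prop} (c : ℤ) (hc : ∀ n, c < n → P n)
    (h : ∀ n, P (n + 1) → P n) (n : ℤ) : P n := by
  by_cases hn : c < n
  · exact hc n hn
  · obtain ⟨k, hk⟩ := Int.le.dest (not_lt.1 hn)
    induction k generalizing n with
    | zero => exact h n (hc _ (by lia))
    | succ k ih =>
      refine h n ?_
      by_cases hn' : c < n + 1
      · exact hc _ hn'
      · exact ih (n + 1) hn' (by push_cast at hk; lia)

omit [∀ n, Injective (I.X n)] in
-- A component goes from `Hom(M, I^p)` to `I^(p+n)`: the source vanishes if `p < a`, and otherwise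
-- `p + n > b` and the target vanishes. The bound does not depend on `M`, so it can start an
-- induction in which `M` varies.
lemma isZero_bidualComplex_X (M : ModuleCat.{u} A) (a b : ℤ) [I.IsStrictlyGE a]
    [I.IsStrictlyLE b] (n : ℤ) (hn : b - a < n) :
    Limits.IsZero ((bidualComplex M I).X n) := by
  rw [ModuleCat.isZero_iff_subsingleton]
  refine subsingleton_of_forall_eq 0 ?_
  intro (z : Cochain (dualComplex M I) I n)
  change z = 0
  ext p q hpq φ : 3
  by_cases hp : p < a
  · have hφ : φ = 0 := (I.isZero_of_isStrictlyGE a p hp).eq_of_tgt (show M ⟶ I.X p from φ) 0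
    rw [hφ, map_zero, map_zero]
  · have hI := I.isZero_of_isStrictlyLE b q (by lia)
    rw [hI.eq_of_tgt (z.v p q hpq) 0]
    rfl

open HomologySequence in
/-- Let `I` be a bounded complex of injective modules over a noetherian ring such that
`A ⟶ Hom_A(I, I)` is a quasi-isomorphism. Then any finitely generated module is
quasi-isomorphic to its double dual relatively to `I`. -/
lemma quasiIso_toBidual [IsNoetherianRing A] [QuasiIso (scalarsToEnd I)] (a b : ℤ)
    [I.IsStrictlyGE a] [I.IsStrictlyLE b] (M : ModuleCat.{u} A) [Module.Finite A M] :
    QuasiIso (toBidual M I) := by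
  -- The bound `0` concerns `N` placed in degree zero, the bound `b - a` its double dual.
  have hzero (N : ModuleCat.{u} A) (n : ℤ) (hn : max 0 (b - a) < n) :
      Limits.IsZero (((single (ModuleCat.{u} A) (ComplexShape.up ℤ) 0).obj N).homology n) ∧
        Limits.IsZero ((bidualComplex N I).homology n) := by
    constructor
    · exact (exactAt_single_obj _ _ _ _ (by lia)).isZero_homology
    · exact ShortComplex.isZero_homology_of_isZero_X₂ _
        (isZero_bidualComplex_X N a b n (lt_of_le_of_lt (le_max_right _ _) hn))
  -- The module is quantified inside the induction: surjectivity for `N` in degree `n` uses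
  -- surjectivity for its syzygy `N'` in degree `n + 1`.
  have hepi (n : ℤ) : ∀ (N : ModuleCat.{u} A) [Module.Finite A N],
      Epi (homologyMap (toBidual N I) n) := by
    induction n using int_descending_induction (c := max 0 (b - a)) with
    | hc n hn => exact fun N _ => (hzero N n hn).2.epi _
    | h n ih =>
      intro N _
      obtain ⟨r, N', f, g, w, hS⟩ := exists_shortExact_of_finite N
      have : Module.Finite A N' := Module.Finite.of_injective f.hom
        ((ModuleCat.mono_iff_injective f).1 hS.mono_f)
      have hF := quasiIso_toBidual_fin (I := I) r
      refine epi_homologyMap_τ₃ (toBidualShortComplex (ShortComplex.mk f g w) I)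
        (shortExact_map_single hS) (bidualShortComplex_shortExact hS) n ?_ ?_ ?_
      · exact inferInstanceAs (Epi (homologyMap (toBidual (ModuleCat.of A (Fin r → A)) I) n))
      · rintro j rfl
        exact ih N'
      · rintro j rfl
        exact inferInstanceAs
          (Mono (homologyMap (toBidual (ModuleCat.of A (Fin r → A)) I) (n + 1)))
  -- Injectivity for `N` in degree `n` needs surjectivity for `N'` in the same degree, so
  -- surjectivity has to be known for all modules beforehand.
  have hmono (n : ℤ) : ∀ (N : ModuleCat.{u} A) [Module.Finite A N],
      Mono (homologyMap (toBidual N I) n) := by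
    induction n using int_descending_induction (c := max 0 (b - a)) with
    | hc n hn => exact fun N _ => (hzero N n hn).1.mono _
    | h n ih =>
      intro N _
      obtain ⟨r, N', f, g, w, hS⟩ := exists_shortExact_of_finite N
      have : Module.Finite A N' := Module.Finite.of_injective f.hom
        ((ModuleCat.mono_iff_injective f).1 hS.mono_f)
      have hF := quasiIso_toBidual_fin (I := I) r
      refine mono_homologyMap_τ₃ (toBidualShortComplex (ShortComplex.mk f g w) I)
        (shortExact_map_single hS) (bidualShortComplex_shortExact hS) n (hepi n N') ?_ ?_
      · exact inferInstanceAs (Mono (homologyMap (toBidual (ModuleCat.of A (Fin r → A)) I) n))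
      · rintro j rfl
        exact ih N'
  rw [quasiIso_iff]
  intro n
  rw [quasiIsoAt_iff_isIso_homologyMap]
  have := hepi n M
  have := hmono n M
  exact isIso_of_mono_of_epi _

/-- Let `I` be a bounded below complex of injective modules with finitely generated cohomology
over a noetherian ring. Then `Hom_A(M, I)` has finitely generated cohomology for any finitely
generated module `M`. -/
lemma finite_homology_dualComplex [IsNoetherianRing A] (a : ℤ) [I.IsStrictlyGE a]
    (hI : ∀ n, Module.Finite A (I.homology n)) (M : ModuleCat.{u} A) [Module.Finite A M] (n : ℤ) :
    Module.Finite A ((dualComplex M I).homology n) := by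
  -- Being noetherian passes to the middle of a three-term exact sequence even when the ends are not
  -- short exact, so it replaces finite generation throughout.
  have hexact {S : ShortComplex (ModuleCat.{u} A)} (hS : S.Exact) (_ : IsNoetherian A S.X₁)
      (_ : IsNoetherian A S.X₃) : IsNoetherian A S.X₂ :=
    isNoetherian_of_range_eq_ker S.f.hom S.g.hom hS.moduleCat_range_eq_ker
  have hfree (r : ℕ) (n : ℤ) :
      IsNoetherian A ((dualComplex (ModuleCat.of A (Fin r → A)) I).homology n) := by
    induction r with
    | zero =>
      have h : Limits.IsZero ((dualComplex (ModuleCat.of A (Fin 0 → A)) I).homology n) := by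
        apply ShortComplex.isZero_homology_of_isZero_X₂
        rw [ModuleCat.isZero_iff_subsingleton]
        exact subsingleton_of_forall_eq 0
          fun φ => (ModuleCat.isZero_of_subsingleton (ModuleCat.of A (Fin 0 → A))).eq_of_src
            (show ModuleCat.of A (Fin 0 → A) ⟶ I.X n from φ) 0
      have := ModuleCat.subsingleton_of_isZero h
      infer_instance
    | succ r ih =>
      refine hexact ((dualShortComplex_shortExact
        (finSuccShortComplex_shortExact (A := A) r) I).homology_exact₂ n) ih ?_
      have := hI n
      exact isNoetherian_of_linearEquiv
        ((homologyMapIso (dualComplexSelfIso I) n).symm.toLinearEquiv)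
  -- The connecting map brings in the syzygy in degree `n - 1`, so the induction ascends from the
  -- lower bound `a`; no upper bound on `I` is involved.
  have hall (k : ℕ) : ∀ (n : ℤ), n < a + k → ∀ (N : ModuleCat.{u} A) [Module.Finite A N],
      IsNoetherian A ((dualComplex N I).homology n) := by
    induction k with
    | zero =>
      intro n hn N _
      have h : Limits.IsZero ((dualComplex N I).homology n) := by
        apply ShortComplex.isZero_homology_of_isZero_X₂
        rw [ModuleCat.isZero_iff_subsingleton]
        exact subsingleton_of_forall_eq 0
          fun φ => (I.isZero_of_isStrictlyGE a n (by simpa using hn)).eq_of_tgt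
            (show N ⟶ I.X n from φ) 0
      have := ModuleCat.subsingleton_of_isZero h
      infer_instance
    | succ k ih =>
      intro n hn N _
      obtain ⟨r, N', f, g, w, hS⟩ := exists_shortExact_of_finite N
      have : Module.Finite A N' := Module.Finite.of_injective f.hom
        ((ModuleCat.mono_iff_injective f).1 hS.mono_f)
      exact hexact ((dualShortComplex_shortExact hS I).homology_exact₁ (n - 1) n (by simp))
        (ih (n - 1) (by push_cast at hn; lia) N') (hfree r n)
  have := hall (n - a + 1).toNat n (by lia) M
  infer_instance

end Biduality

/-! ### Replacing a dualizing complex by a bounded complex of injectives. -/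

section Resolutions

variable {A : Type u} [CommRing A] [HasDerivedCategory.{w} (ModuleCat.{u} A)]

instance isIso_rHomUnit_app (K : CochainComplex (ModuleCat.{u} A) ℤ)
    (I : CochainComplex.Plus (ModuleCat.{u} A)) [∀ n, Injective (I.obj.X n)] :
    IsIso ((rHomUnit K).app ((HomotopyCategory.Plus.quotient _).obj I)) := by
  have : (rHom K).IsRightDerivedFunctor (rHomUnit K)
      (HomotopyCategory.Plus.quasiIso (ModuleCat.{u} A)) := by
    dsimp only [rHom, rHomUnit]
    infer_instance
  infer_instance

lemma isIso_Qh_map_quotient_map_iff {K L : CochainComplex (ModuleCat.{u} A) ℤ} (φ : K ⟶ L) :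
    IsIso (DerivedCategory.Qh.map ((HomotopyCategory.quotient _ (ComplexShape.up ℤ)).map φ)) ↔
      QuasiIso φ :=
  (NatIso.isIso_map_iff (DerivedCategory.quotientCompQhIso (ModuleCat.{u} A)) φ).trans
    (DerivedCategory.isIso_Q_map_iff_quasiIso _ φ)

/-- `H^n(RHom_A(K, I)) ≅ H^n(Hom_A(K, I))` if `I` consists of injective modules. -/
def homologyRHomIso (K : CochainComplex (ModuleCat.{u} A) ℤ)
    (I : CochainComplex.Plus (ModuleCat.{u} A)) [∀ n, Injective (I.obj.X n)] (n : ℤ) :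
    (DerivedCategory.homologyFunctor (ModuleCat.{u} A) n).obj
      ((rHom K).obj (DerivedCategory.Plus.Q.obj I)) ≅ (homComplex K I.obj).homology n :=
  (DerivedCategory.homologyFunctor (ModuleCat.{u} A) n).mapIso
    ((asIso ((rHomUnit K).app ((HomotopyCategory.Plus.quotient _).obj I))).symm ≪≫
      (DerivedCategory.quotientCompQhIso (ModuleCat.{u} A)).app (homComplex K I.obj)) ≪≫
    (DerivedCategory.homologyFunctorFactors (ModuleCat.{u} A) n).app (homComplex K I.obj)

/-- The property `θ : A ≅ RHom_A(I, I)` is a condition on the complex `Hom_A(I, I)` when `I`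
consists of injective modules. -/
lemma isIso_theta_iff (I : CochainComplex.Plus (ModuleCat.{u} A)) [∀ n, Injective (I.obj.X n)] :
    IsIso (theta I) ↔ QuasiIso (scalarsToEnd I.obj) := by
  rw [← isIso_Qh_map_quotient_map_iff]
  have := isIso_rHomUnit_app I.obj I
  exact isIso_comp_right_iff _ ((rHomUnit I.obj).app ((HomotopyCategory.Plus.quotient _).obj I))

omit [HasDerivedCategory.{w} (ModuleCat.{u} A)] in
lemma isKInjective_of_plus (I : CochainComplex.Plus (ModuleCat.{u} A))
    [∀ n, Injective (I.obj.X n)] : I.obj.IsKInjective := by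
  obtain ⟨n, _⟩ := I.property
  exact isKInjective_of_injective I.obj n

/-- `I` is an injective resolution of `K` by a monomorphism `i`, as `quasiIso_homComplexPrecomp`
requires. `RHom(K, K)` is computed by `Hom(K, I)`, which precomposition with `i` identifies with
`Hom(I, I)`. -/
lemma exists_injective_of_isIso_theta (K : CochainComplex.Plus (ModuleCat.{u} A))
    (hK : IsIso (theta K)) :
    ∃ I : CochainComplex.Plus (ModuleCat.{u} A), (∀ n, Injective (I.obj.X n)) ∧
      Nonempty (DerivedCategory.Plus.Q.obj K ≅ DerivedCategory.Plus.Q.obj I) ∧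
        QuasiIso (scalarsToEnd I.obj) := by
  obtain ⟨n, _⟩ := K.property
  obtain ⟨L, i, _, _, _, hL⟩ :=
    CochainComplex.Plus.modelCategoryQuillen.exists_mono_quasiIso_injective K.obj (n - 1) n
      (by simp)
  let I : CochainComplex.Plus (ModuleCat.{u} A) := ⟨L, n - 1, hL⟩
  have hI (p : ℤ) : Injective (I.obj.X p) := inferInstanceAs (Injective (L.X p))
  have := isKInjective_of_plus I
  let φ : K ⟶ I := ObjectProperty.homMk i
  have : IsIso (DerivedCategory.Plus.Q.map φ) := by
    rw [← isIso_iff_of_reflects_iso _ DerivedCategory.Plus.ι]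
    exact (isIso_Qh_map_quotient_map_iff i).2 inferInstance
  refine ⟨I, hI, ⟨asIso (DerivedCategory.Plus.Q.map φ)⟩, ?_⟩
  -- Naturality of the unit moves `θ` from `K`, where the unit need not be invertible, to `I`, where
  -- it is.
  have hnat := (rHomUnit K.obj).naturality ((HomotopyCategory.Plus.quotient _).map φ)
  have h₁ : IsIso (theta K ≫ (rHom K.obj).map (DerivedCategory.Plus.Q.map φ)) := inferInstance
  have h₂ : theta K ≫ (rHom K.obj).map (DerivedCategory.Plus.Q.map φ) =
      DerivedCategory.Qh.map ((HomotopyCategory.quotient _ _).map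
        (scalarsToEnd K.obj ≫ homComplexMap K.obj i)) ≫
        (rHomUnit K.obj).app ((HomotopyCategory.Plus.quotient _).obj I) := by
    have hcomp : DerivedCategory.Qh.map ((HomotopyCategory.quotient _ _).map
        (scalarsToEnd K.obj ≫ homComplexMap K.obj i)) =
        DerivedCategory.Qh.map ((HomotopyCategory.quotient _ _).map (scalarsToEnd K.obj)) ≫
          DerivedCategory.Qh.map ((HomotopyCategory.quotient _ _).map
            (homComplexMap K.obj i)) := by
      rw [← Functor.map_comp, ← Functor.map_comp]
    exact (Category.assoc _ _ _).trans ((congrArg (DerivedCategory.Qh.map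
      ((HomotopyCategory.quotient _ _).map (scalarsToEnd K.obj)) ≫ ·) hnat.symm).trans
        ((Category.assoc _ _ _).symm.trans (congrArg
          (· ≫ (rHomUnit K.obj).app ((HomotopyCategory.Plus.quotient _).obj I)) hcomp.symm)))
  have := isIso_rHomUnit_app K.obj I
  have h₃ := (isIso_Qh_map_quotient_map_iff (scalarsToEnd K.obj ≫ homComplexMap K.obj i)).1
    ((isIso_comp_right_iff _ ((rHomUnit K.obj).app
      ((HomotopyCategory.Plus.quotient _).obj I))).1 (h₂ ▸ h₁))
  rw [scalarsToEnd_comp] at h₃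
  have := quasiIso_homComplexPrecomp i L
  exact quasiIso_of_comp_right (scalarsToEnd L) (homComplexPrecomp i L)

omit [HasDerivedCategory.{w} (ModuleCat.{u} A)] in
/-- If `Hom_A(M, I)` is exact in degree `n` for all modules `M`, then the inclusion of the
cocycles of degree `n` lifts through the differential. -/
lemma exists_section_of_exactAt {I : CochainComplex (ModuleCat.{u} A) ℤ} (m n : ℤ)
    (hmn : m + 1 = n)
    (h : ∀ M : ModuleCat.{u} A,
      (homComplex ((single (ModuleCat.{u} A) (ComplexShape.up ℤ) 0).obj M) I).ExactAt n) :
    ∃ s : I.cycles n ⟶ I.X m, s ≫ I.d m n = I.iCycles n := by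
  -- The test module is the module of cocycles itself: its inclusion into `I.X n` is a cocycle of
  -- the Hom complex, hence a coboundary.
  have hn := (homComplex_exactAt_iff _ _ n).1 (h (I.cycles n))
    (Cochain.fromSingleMk (p := 0) (I.iCycles n) (zero_add n))
    ((Cochain.δ_fromSingleMk _ (zero_add n) (n + 1) (n + 1) (zero_add _)).trans (by simp; rfl))
  obtain rfl : m = n - 1 := by lia
  obtain ⟨y, hy⟩ := hn
  obtain ⟨s, rfl⟩ := Cochain.fromSingleMk_surjective y (n - 1) (zero_add _)
  refine ⟨s, (Cochain.fromSingleEquiv (p := 0) (zero_add n)).symm.injective ?_⟩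
  exact (Cochain.δ_fromSingleMk _ (zero_add _) n n (zero_add n)).symm.trans hy

omit [HasDerivedCategory.{w} (ModuleCat.{u} A)] in
-- Above `b` the map from `I^(n-1)` onto its boundaries in the cocycles `Z^n` has a section, so
-- every cocycle is a boundary.
lemma isLE_of_exactAt {I : CochainComplex (ModuleCat.{u} A) ℤ} (b : ℤ)
    (h : ∀ (M : ModuleCat.{u} A) (n : ℤ), b < n →
      (homComplex ((single (ModuleCat.{u} A) (ComplexShape.up ℤ) 0).obj M) I).ExactAt n) :
    I.IsLE b := by
  rw [isLE_iff]
  intro n hn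
  obtain ⟨s, hs⟩ := exists_section_of_exactAt (n - 1) n (by simp) fun M => h M n hn
  rw [exactAt_iff_isZero_homology, Limits.IsZero.iff_id_eq_zero, ← cancel_epi (I.homologyπ n)]
  have : s ≫ I.toCycles (n - 1) n = 𝟙 _ := by
    rw [← cancel_mono (I.iCycles n)]
    simpa using hs
  rw [Limits.comp_zero, Category.comp_id, ← Category.id_comp (I.homologyπ n), ← this]
  simp

omit [HasDerivedCategory.{w} (ModuleCat.{u} A)] in
-- With `s` a section of `I^b ⟶ Z^(b+1)`, the endomorphism `1 - s ∘ d` of `I^b` retracts it onto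
-- `Z^b`, a direct summand of an injective. This is the top term of the truncation.
lemma injective_cycles_of_exactAt {I : CochainComplex (ModuleCat.{u} A) ℤ} (b : ℤ)
    [Injective (I.X b)]
    (h : ∀ M : ModuleCat.{u} A,
      (homComplex ((single (ModuleCat.{u} A) (ComplexShape.up ℤ) 0).obj M) I).ExactAt (b + 1)) :
    Injective (I.cycles b) := by
  obtain ⟨s, hs⟩ := exists_section_of_exactAt b (b + 1) rfl h
  exact Retract.injective
    { i := I.iCycles b
      r := I.liftCycles (𝟙 _ - I.toCycles b (b + 1) ≫ s) (b + 1) (by simp) (by simp [hs])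
      retract := by
        rw [← cancel_mono (I.iCycles b)]
        have : I.iCycles b ≫ I.toCycles b (b + 1) = 0 := by
          rw [← cancel_mono (I.iCycles (b + 1))]
          simp
        simp [reassoc_of% this] }

/-- A complex of injective modules of finite injective dimension is quasi-isomorphic to its
canonical truncation in sufficiently large degree, which also consists of injective modules. -/
lemma exists_bounded_injective {I : CochainComplex.Plus (ModuleCat.{u} A)}
    (hI : ∀ n, Injective (I.obj.X n)) (hθ : QuasiIso (scalarsToEnd I.obj))
    (hfin : HasFiniteInjectiveDimension (DerivedCategory.Plus.Q.obj I)) :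
    ∃ T : CochainComplex.Plus (ModuleCat.{u} A), (∀ n, Injective (T.obj.X n)) ∧
      (∃ b : ℤ, T.obj.IsStrictlyLE b) ∧
      Nonempty (DerivedCategory.Plus.Q.obj T ≅ DerivedCategory.Plus.Q.obj I) ∧
        QuasiIso (scalarsToEnd T.obj) := by
  obtain ⟨b, hb⟩ := hfin
  have hb' (M : ModuleCat.{u} A) (n : ℤ) (hn : (b : ℤ) < n) :
      (homComplex ((single (ModuleCat.{u} A) (ComplexShape.up ℤ) 0).obj M) I.obj).ExactAt n := by
    have := hb M n hn
    rw [exactAt_iff_isZero_homology]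
    exact (ModuleCat.isZero_of_subsingleton (ext M (DerivedCategory.Plus.Q.obj I) n)).of_iso
      (homologyRHomIso _ I n).symm
  have := isLE_of_exactAt (I := I.obj) b hb'
  obtain ⟨a, ha⟩ := I.property
  let T : CochainComplex.Plus (ModuleCat.{u} A) := ⟨I.obj.truncLE b, a, inferInstance⟩
  have hT (n : ℤ) : Injective (T.obj.X n) := by
    obtain hn | rfl | hn := lt_trichotomy n b
    · exact Injective.of_iso (I.obj.truncLEXIso b n hn).symm inferInstance
    · have := injective_cycles_of_exactAt (I := I.obj) b fun M => hb' M _ (by lia)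
      exact Injective.of_iso (I.obj.truncLEXIsoCycles b).symm inferInstance
    · exact Injective.of_iso ((I.obj.truncLE b).isZero_of_isStrictlyLE b n hn).isoZero.symm
        inferInstance
  have := isKInjective_of_plus I
  have := isKInjective_of_plus T
  let i : T.obj ⟶ I.obj := I.obj.ιTruncLE b
  have : QuasiIso i := inferInstanceAs (QuasiIso (I.obj.ιTruncLE b))
  have : Mono i := inferInstanceAs (Mono (HomologicalComplex.ιTruncLE _ _))
  have hi : IsIso (DerivedCategory.Plus.Q.map (ObjectProperty.homMk i : T ⟶ I)) := by
    rw [← isIso_iff_of_reflects_iso _ DerivedCategory.Plus.ι]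
    exact (isIso_Qh_map_quotient_map_iff i).2 inferInstance
  refine ⟨T, hT, ⟨b, inferInstanceAs ((I.obj.truncLE b).IsStrictlyLE b)⟩, ⟨@asIso _ _ _ _ _ hi⟩, ?_⟩
  -- `Hom(T, T)` and `Hom(I, I)` are both quasi-isomorphic to `Hom(T, I)`, compatibly with scalars.
  have := quasiIso_homComplexPrecomp i I.obj
  have := quasiIso_homComplexMap T.obj i
  have : QuasiIso (scalarsToEnd T.obj ≫ homComplexMap T.obj i) := by
    rw [scalarsToEnd_comp]
    infer_instance
  exact quasiIso_of_comp_right (scalarsToEnd T.obj) (homComplexMap T.obj i)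

lemma HasFiniteInjectiveDimension.of_iso {X Y : DerivedCategory.Plus (ModuleCat.{u} A)}
    (h : HasFiniteInjectiveDimension X) (e : X ≅ Y) : HasFiniteInjectiveDimension Y := by
  obtain ⟨b, hb⟩ := h
  refine ⟨b, fun M i hi => ?_⟩
  have : Subsingleton (((rHom ((single (ModuleCat.{u} A) (ComplexShape.up ℤ) 0).obj M)) ⋙
    DerivedCategory.homologyFunctor (ModuleCat.{u} A) i).obj X) := hb M i hi
  exact (((rHom _) ⋙ DerivedCategory.homologyFunctor (ModuleCat.{u} A) i).mapIso
    e.symm).toLinearEquiv.toEquiv.subsingleton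

/-- A dualizing complex is represented by a bounded complex of injective modules `T` such that
`A ⟶ Hom_A(T, T)` is a quasi-isomorphism. -/
lemma IsDualizing.exists_bounded_injective {R : DerivedCategory.Plus (ModuleCat.{u} A)}
    (hR : IsDualizing R) :
    ∃ T : CochainComplex.Plus (ModuleCat.{u} A), (∀ n, Injective (T.obj.X n)) ∧
      (∃ b : ℤ, T.obj.IsStrictlyLE b) ∧
      Nonempty (DerivedCategory.Plus.Q.obj T ≅ R) ∧ QuasiIso (scalarsToEnd T.obj) := by
  obtain ⟨K, ⟨e⟩, hK⟩ := hR.isIso_theta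
  obtain ⟨I, hI, ⟨e'⟩, hθ⟩ := exists_injective_of_isIso_theta K hK
  have hfin := hR.hasFiniteInjectiveDimension.of_iso (e.symm ≪≫ e')
  obtain ⟨T, hT, hb, ⟨e''⟩, hθ'⟩ := DualizingComplex.exists_bounded_injective hI hθ hfin
  exact ⟨T, hT, hb, ⟨e'' ≪≫ e'.symm ≪≫ e⟩, hθ'⟩

end Resolutions

/-! ### Coextension of scalars and the endomorphism complex of `Hom_A(B, I)`. -/

section ChangeOfRings

variable {A B : Type u} [CommRing A] [CommRing B] (f : A →+* B)

lemma restrictScalars_hom_smul {M : ModuleCat.{u} B} {N : ModuleCat.{u} A}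
    (g : (ModuleCat.restrictScalars.{u, u, u} f).obj M ⟶ N) (a : A) (m : M) :
    g.hom (f a • m : M) = a • g.hom m :=
  g.hom.map_smul' a m

/-- The complex of `B`-modules `Hom_A(B, I)`. -/
abbrev coextendComplex (I : CochainComplex (ModuleCat.{u} A) ℤ) :
    CochainComplex (ModuleCat.{u} B) ℤ :=
  ((ModuleCat.coextendScalars.{u, u, u} f).mapHomologicalComplex (ComplexShape.up ℤ)).obj I

/-- Restriction of scalars for complexes. -/
abbrev restrictComplex (K : CochainComplex (ModuleCat.{u} B) ℤ) :
    CochainComplex (ModuleCat.{u} A) ℤ :=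
  ((ModuleCat.restrictScalars.{u, u, u} f).mapHomologicalComplex (ComplexShape.up ℤ)).obj K

instance injective_coextendScalars (M : ModuleCat.{u} A) [Injective M] :
    Injective ((ModuleCat.coextendScalars.{u, u, u} f).obj M) :=
  (ModuleCat.restrictCoextendScalarsAdj.{u, u, u} f).map_injective M inferInstance

/-- The ring `B` as an `A`-module. -/
abbrev restrictSelf : ModuleCat.{u} A :=
  (ModuleCat.restrictScalars.{u, u, u} f).obj (ModuleCat.of B B)

/-- The identification of the `A`-module of linear maps from `B` to `M` with the restriction of
scalars of the `B`-module `Hom_A(B, M)`. -/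
def coextendOfHom (M : ModuleCat.{u} A) :
    ModuleCat.of A (restrictSelf f ⟶ M) ⟶ (ModuleCat.restrictScalars.{u, u, u} f).obj
      ((ModuleCat.coextendScalars.{u, u, u} f).obj M) :=
  ModuleCat.ofHom (Y := (ModuleCat.restrictScalars.{u, u, u} f).obj
      ((ModuleCat.coextendScalars.{u, u, u} f).obj M))
  { toFun φ := (ModuleCat.CoextendScalars.equiv f M).symm φ.hom
    map_add' _ _ := rfl
    map_smul' a φ := by
      apply (ModuleCat.CoextendScalars.equiv f M).injective
      refine LinearMap.ext fun (b : B) => ?_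
      -- On the coextended module `a` acts on the argument, giving `φ (b * f a)`, while on the
      -- source it acts on the value; commutativity of `B` reconciles the two.
      exact (restrictScalars_hom_smul f (M := ModuleCat.of B B) φ a b).symm.trans
        (congrArg (fun x : B => (ConcreteCategory.hom φ) x) (mul_comm (f a) b)) }

instance isIso_coextendOfHom (M : ModuleCat.{u} A) : IsIso (coextendOfHom f M) := by
  rw [ConcreteCategory.isIso_iff_bijective]
  refine ⟨fun (φ : restrictSelf f ⟶ M) (ψ : restrictSelf f ⟶ M) h => ?_, fun φ =>
    ⟨ModuleCat.ofHom (X := restrictSelf f) (ModuleCat.CoextendScalars.equiv f M φ), rfl⟩⟩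
  exact ModuleCat.hom_ext (congrArg (ModuleCat.CoextendScalars.equiv f M) h)

/-- `Hom_A(B, I)` viewed as a complex of `A`-modules. -/
def dualComplexRestrictSelfIso (I : CochainComplex (ModuleCat.{u} A) ℤ) :
    dualComplex (restrictSelf f) I ≅ restrictComplex f (coextendComplex f I) :=
  Hom.isoOfComponents (fun n => @asIso _ _ _ _ _ (isIso_coextendOfHom f (I.X n)))
    (fun _ _ _ => rfl)

/-- Evaluation at `1`, as a morphism of complexes of `A`-modules `Hom_A(B, I) ⟶ I`. -/
def coextendCounit (I : CochainComplex (ModuleCat.{u} A) ℤ) :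
    restrictComplex f (coextendComplex f I) ⟶ I where
  f n := (ModuleCat.restrictCoextendScalarsAdj.{u, u, u} f).counit.app (I.X n)
  comm' i j _ :=
    ((ModuleCat.restrictCoextendScalarsAdj.{u, u, u} f).counit.naturality (I.d i j)).symm

/-- The adjunction between restriction and coextension of scalars, at the level of cochains. -/
def cochainAdjunctionX (K : CochainComplex (ModuleCat.{u} B) ℤ)
    (I : CochainComplex (ModuleCat.{u} A) ℤ) (n : ℤ) :
    (ModuleCat.restrictScalars.{u, u, u} f).obj ((homComplex K (coextendComplex f I)).X n) ⟶
      (homComplex (restrictComplex f K) I).X n :=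
  ModuleCat.ofHom (X := (ModuleCat.restrictScalars.{u, u, u} f).obj
    ((homComplex K (coextendComplex f I)).X n)) (Y := (homComplex (restrictComplex f K) I).X n)
  { toFun z := ((z : Cochain K (coextendComplex f I) n).map
      (ModuleCat.restrictScalars.{u, u, u} f)).comp (Cochain.ofHom (coextendCounit f I))
        (add_zero n)
    map_add' z z' := (congrArg (fun y => Cochain.comp y (Cochain.ofHom (coextendCounit f I))
      (add_zero n)) (Cochain.map_add _ _ _)).trans (Cochain.add_comp _ _ _ _)
    map_smul' a z := by
      refine Cochain.ext _ _ fun p q hpq => ?_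
      rw [Cochain.comp_zero_cochain_v, Cochain.ofHom_v]
      refine Eq.trans ?_ (congrArg (a • ·) (Cochain.comp_zero_cochain_v
        ((z : Cochain K (coextendComplex f I) n).map (ModuleCat.restrictScalars.{u, u, u} f))
        (Cochain.ofHom (coextendCounit f I)) p q hpq)).symm
      rw [Cochain.ofHom_v]
      ext x
      exact restrictScalars_hom_smul f ((coextendCounit f I).f q) a
        (Cochain.v (F := K) (G := coextendComplex f I) z p q hpq x) }

/-- The adjunction between restriction and coextension of scalars, for complexes of morphisms. -/
def homComplexAdjunction (K : CochainComplex (ModuleCat.{u} B) ℤ)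
    (I : CochainComplex (ModuleCat.{u} A) ℤ) :
    restrictComplex f (homComplex K (coextendComplex f I)) ⟶
      homComplex (restrictComplex f K) I where
  f n := cochainAdjunctionX f K I n
  comm' i j _ := by
    ext z
    refine (δ_comp_ofHom ((z : Cochain K (coextendComplex f I) i).map
      (ModuleCat.restrictScalars.{u, u, u} f)) (coextendCounit f I) j).trans ?_
    exact congrArg (fun y => Cochain.comp y (Cochain.ofHom (coextendCounit f I)) (add_zero j))
      (δ_map (z := (z : Cochain K (coextendComplex f I) i)) (m := j)
        (Φ := ModuleCat.restrictScalars.{u, u, u} f))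

lemma homComplexAdjunction_f_v (K : CochainComplex (ModuleCat.{u} B) ℤ)
    (I : CochainComplex (ModuleCat.{u} A) ℤ) (n : ℤ) (z : Cochain K (coextendComplex f I) n)
    (p q : ℤ) (hpq : p + n = q) :
    Cochain.v (F := restrictComplex f K) (G := I) ((homComplexAdjunction f K I).f n z) p q hpq =
      (ModuleCat.restrictScalars.{u, u, u} f).map (z.v p q hpq) ≫
        (ModuleCat.restrictCoextendScalarsAdj.{u, u, u} f).counit.app (I.X q) := by
  refine (Cochain.comp_zero_cochain_v (z.map (ModuleCat.restrictScalars.{u, u, u} f))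
    (Cochain.ofHom (coextendCounit f I)) p q hpq).trans ?_
  rw [Cochain.ofHom_v]
  rfl

instance isIso_homComplexAdjunction (K : CochainComplex (ModuleCat.{u} B) ℤ)
    (I : CochainComplex (ModuleCat.{u} A) ℤ) : IsIso (homComplexAdjunction f K I) := by
  let adj := ModuleCat.restrictCoextendScalarsAdj.{u, u, u} f
  -- On each component the map is the hom-set bijection of the adjunction between restriction and
  -- coextension.
  have hv (n : ℤ) (z : Cochain K (coextendComplex f I) n) (p q : ℤ) (hpq : p + n = q) :
      Cochain.v (F := restrictComplex f K) (G := I) ((homComplexAdjunction f K I).f n z) p q hpq =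
        (adj.homEquiv (K.X p) (I.X q)).symm (z.v p q hpq) :=
    (homComplexAdjunction_f_v f K I n z p q hpq).trans
      (adj.homEquiv_counit (X := K.X p) (g := z.v p q hpq)).symm
  have (n : ℤ) : IsIso ((homComplexAdjunction f K I).f n) := by
    rw [ConcreteCategory.isIso_iff_bijective]
    constructor
    · intro (z : Cochain K (coextendComplex f I) n) (z' : Cochain K (coextendComplex f I) n) h
      refine Cochain.ext _ _ fun p q hpq => (adj.homEquiv (K.X p) (I.X q)).symm.injective ?_
      exact (hv n z p q hpq).symm.trans ((Cochain.congr_v h p q hpq).trans (hv n z' p q hpq))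
    · intro (y : Cochain (restrictComplex f K) I n)
      refine ⟨(Cochain.mk fun p q hpq => adj.homEquiv (K.X p) (I.X q) (y.v p q hpq) :
        Cochain K (coextendComplex f I) n), ?_⟩
      refine Cochain.ext _ _ fun p q hpq => (hv n (Cochain.mk fun p q hpq =>
        adj.homEquiv (K.X p) (I.X q) (y.v p q hpq)) p q hpq).trans
          ((adj.homEquiv (K.X p) (I.X q)).symm_apply_apply (y.v p q hpq))
  exact Hom.isIso_of_components _

/-- The double dual of `B` is the complex of endomorphisms of `Hom_A(B, I)`. -/
lemma restrict_scalarsToEnd (I : CochainComplex (ModuleCat.{u} A) ℤ) :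
    (singleMapHomologicalComplex (ModuleCat.restrictScalars.{u, u, u} f)
      (ComplexShape.up ℤ) 0).inv.app (ModuleCat.of B B) ≫
      ((ModuleCat.restrictScalars.{u, u, u} f).mapHomologicalComplex (ComplexShape.up ℤ)).map
        (scalarsToEnd (coextendComplex f I)) ≫
      homComplexAdjunction f (coextendComplex f I) I ≫
      homComplexPrecomp (dualComplexRestrictSelfIso f I).hom I =
    toBidual (restrictSelf f) I := by
  apply single_hom_ext
  intro (b : B)
  refine Eq.trans ?_ (toBidual_f_apply (restrictSelf f) I b).symm
  have h₁ : ((singleMapHomologicalComplex (ModuleCat.restrictScalars.{u, u, u} f)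
      (ComplexShape.up ℤ) 0).inv.app (ModuleCat.of B B)).f 0
        ((singleObjXSelf (ComplexShape.up ℤ) 0 (restrictSelf f)).inv b) =
      ((ModuleCat.restrictScalars.{u, u, u} f).map
        (singleObjXSelf (ComplexShape.up ℤ) 0 (ModuleCat.of B B)).inv) b := by
    rw [singleMapHomologicalComplex_inv_app_self]
    refine (ModuleCat.comp_apply _ _ _).trans (congrArg _ ?_)
    exact ConcreteCategory.congr_hom (singleObjXSelf (ComplexShape.up ℤ) 0
      (restrictSelf f)).inv_hom_id b
  refine (congrArg _ h₁).trans ?_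
  refine (congrArg (fun z => (homComplexPrecomp (dualComplexRestrictSelfIso f I).hom I).f 0
    ((homComplexAdjunction f (coextendComplex f I) I).f 0 z))
      (scalarsToEnd_f_apply (coextendComplex f I) b)).trans ?_
  refine Cochain.ext₀ _ _ fun p => ?_
  let z : Cochain (coextendComplex f I) (coextendComplex f I) 0 :=
    b • Cochain.ofHom (𝟙 (coextendComplex f I))
  let w : Cochain (restrictComplex f (coextendComplex f I)) I 0 :=
    (homComplexAdjunction f (coextendComplex f I) I).f 0 z
  have hz : z.v p p (add_zero p) = b • 𝟙 ((coextendComplex f I).X p) := by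
    simp [z]
  have h₂ := Cochain.zero_cochain_comp_v (Cochain.ofHom (dualComplexRestrictSelfIso f I).hom) w
    p p (add_zero p)
  rw [Cochain.ofHom_v, homComplexAdjunction_f_v f (coextendComplex f I) I 0 z p p (add_zero p),
    hz] at h₂
  refine h₂.trans ?_
  rw [Cochain.ofHom_v]
  ext (φ : restrictSelf f ⟶ I.X p)
  -- The counit evaluates `b • φ` at `1`, which gives `φ (1 * b)`.
  exact congrArg (fun x : B => (ConcreteCategory.hom φ) x) (one_mul b)

/-- In the factorization `restrict_scalarsToEnd` every other factor is an isomorphism, and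
restriction of scalars, being exact and reflecting isomorphisms, detects quasi-isomorphisms. -/
lemma quasiIso_scalarsToEnd_coextendComplex (I : CochainComplex (ModuleCat.{u} A) ℤ)
    (h : QuasiIso (toBidual (restrictSelf f) I)) :
    QuasiIso (scalarsToEnd (coextendComplex f I)) := by
  have : IsIso (homComplexPrecomp (dualComplexRestrictSelfIso f I).hom I) :=
    (homComplexPrecompIso (dualComplexRestrictSelfIso f I) I).isIso_hom
  rw [← restrict_scalarsToEnd, quasiIso_iff_comp_left, quasiIso_iff_comp_right,
    quasiIso_map_iff_of_preservesHomology] at h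
  exact h

end ChangeOfRings

/-! ### Finiteness conditions read off from representing complexes. -/

section Bounded

variable {A : Type u} [CommRing A] [HasDerivedCategory.{w} (ModuleCat.{u} A)]

/-- The image in `D(Mod A)` of a bounded below complex. -/
def plusQObjIso (K : CochainComplex.Plus (ModuleCat.{u} A)) :
    DerivedCategory.Plus.ι.obj (DerivedCategory.Plus.Q.obj K) ≅ DerivedCategory.Q.obj K.obj :=
  (DerivedCategory.quotientCompQhIso (ModuleCat.{u} A)).app K.obj

lemma IsBoundedFinite.of_iso {X Y : DerivedCategory (ModuleCat.{u} A)} (h : IsBoundedFinite X)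
    (e : X ≅ Y) : IsBoundedFinite Y where
  bounded := by
    obtain ⟨a, b, _, _⟩ := h.bounded
    exact ⟨a, b, DerivedCategory.TStructure.t.isGE_of_iso e a,
      DerivedCategory.TStructure.t.isLE_of_iso e b⟩
  finite i := by
    have := h.finite i
    exact Module.Finite.equiv
      ((DerivedCategory.homologyFunctor (ModuleCat.{u} A) i).mapIso e).toLinearEquiv

lemma IsDualizing.of_iso {X Y : DerivedCategory.Plus (ModuleCat.{u} A)} (h : IsDualizing X)
    (e : X ≅ Y) : IsDualizing Y where
  isBoundedFinite := h.isBoundedFinite.of_iso (DerivedCategory.Plus.ι.mapIso e)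
  hasFiniteInjectiveDimension := h.hasFiniteInjectiveDimension.of_iso e
  isIso_theta := by
    obtain ⟨K, ⟨e'⟩, hK⟩ := h.isIso_theta
    exact ⟨K, ⟨e' ≪≫ e⟩, hK⟩

lemma IsBoundedFinite.finite_homology {K : CochainComplex (ModuleCat.{u} A) ℤ}
    (h : IsBoundedFinite (DerivedCategory.Q.obj K)) (n : ℤ) :
    Module.Finite A (K.homology n) := by
  have : Module.Finite A ((DerivedCategory.Q ⋙
    DerivedCategory.homologyFunctor (ModuleCat.{u} A) n).obj K) := h.finite n
  exact Module.Finite.equiv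
    ((DerivedCategory.homologyFunctorFactors (ModuleCat.{u} A) n).app K).toLinearEquiv

lemma isBoundedFinite_Q_obj (K : CochainComplex (ModuleCat.{u} A) ℤ) (a b : ℤ)
    [K.IsStrictlyGE a] [K.IsStrictlyLE b] (h : ∀ n, Module.Finite A (K.homology n)) :
    IsBoundedFinite (DerivedCategory.Q.obj K) where
  bounded := ⟨a, b, inferInstance, inferInstance⟩
  finite n := by
    have : Module.Finite A
      ((homologyFunctor (ModuleCat.{u} A) (ComplexShape.up ℤ) n).obj K) := h n
    exact Module.Finite.equiv
      ((DerivedCategory.homologyFunctorFactors (ModuleCat.{u} A) n).app K).symm.toLinearEquiv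

lemma hasFiniteInjectiveDimension_Q_obj (I : CochainComplex.Plus (ModuleCat.{u} A))
    [∀ n, Injective (I.obj.X n)] (b : ℤ) [I.obj.IsStrictlyLE b] :
    HasFiniteInjectiveDimension (DerivedCategory.Plus.Q.obj I) := by
  -- The bound must be a natural number while `b` may be negative; in either case `i > b`, and
  -- `Hom(M, I)` vanishes in degree `i`.
  refine ⟨b.toNat, fun M i hi => ?_⟩
  refine ModuleCat.subsingleton_of_isZero (Limits.IsZero.of_iso ?_ (homologyRHomIso _ I i))
  apply ShortComplex.isZero_homology_of_isZero_X₂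
  rw [ModuleCat.isZero_iff_subsingleton]
  refine subsingleton_of_forall_eq 0 fun z => ?_
  refine (Cochain.fromSingleEquiv (p := 0) (zero_add i)).injective ?_
  exact (I.obj.isZero_of_isStrictlyLE b i (by lia)).eq_of_tgt _ _

end Bounded

/-! ### The derived coextension computed on bounded injective complexes. -/

section RHomChangeOfRings

variable {A B : Type u} [CommRing A] [CommRing B] (f : A →+* B)

/-- `Hom_A(B, I)` for a bounded below complex `I`. -/
abbrev coextendPlus (I : CochainComplex.Plus (ModuleCat.{u} A)) :
    CochainComplex.Plus (ModuleCat.{u} B) :=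
  (ModuleCat.coextendScalars.{u, u, u} f).mapCochainComplexPlus.obj I

instance injective_coextendPlus (I : CochainComplex.Plus (ModuleCat.{u} A))
    [∀ n, Injective (I.obj.X n)] (n : ℤ) : Injective ((coextendPlus f I).obj.X n) :=
  injective_coextendScalars f (I.obj.X n)

lemma finite_of_finite_restrictScalars (M : ModuleCat.{u} B)
    (h : Module.Finite A ((ModuleCat.restrictScalars.{u, u, u} f).obj M)) : Module.Finite B M := by
  let _ : Algebra A B := f.toAlgebra
  let _ : Module A M := Module.compHom M f
  have : IsScalarTower A B M := ⟨fun a b m => mul_smul (f a) b m⟩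
  have : Module.Finite A M := h
  exact Module.Finite.of_restrictScalars_finite A B M

/-- Restriction of scalars is exact, so it commutes with cohomology, and generators over `A` also
generate over `B`. -/
lemma finite_homology_of_restrictComplex {K : CochainComplex (ModuleCat.{u} B) ℤ} {n : ℤ}
    (h : Module.Finite A ((restrictComplex f K).homology n)) : Module.Finite B (K.homology n) := by
  apply finite_of_finite_restrictScalars f
  have : Module.Finite A ((K.sc n).map (ModuleCat.restrictScalars.{u, u, u} f)).homology := h
  exact Module.Finite.equiv
    ((K.sc n).mapHomologyIso (ModuleCat.restrictScalars.{u, u, u} f)).toLinearEquiv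

lemma finite_homology_restrictComplex_coextendComplex [IsNoetherianRing A] (hf : f.Finite)
    (I : CochainComplex (ModuleCat.{u} A) ℤ) (a : ℤ) [I.IsStrictlyGE a]
    [∀ n, Injective (I.X n)] (hI : ∀ n, Module.Finite A (I.homology n)) (n : ℤ) :
    Module.Finite A ((restrictComplex f (coextendComplex f I)).homology n) := by
  have : Module.Finite A (restrictSelf f) := hf
  have := finite_homology_dualComplex a hI (restrictSelf f) n
  exact Module.Finite.equiv (homologyMapIso (dualComplexRestrictSelfIso f I) n).toLinearEquiv

variable [HasDerivedCategory.{w} (ModuleCat.{u} A)] [HasDerivedCategory.{w'} (ModuleCat.{u} B)]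

/-- `RHom_A(B, I) ≅ Hom_A(B, I)` if `I` consists of injective modules. -/
def rHomRingIso (I : CochainComplex.Plus (ModuleCat.{u} A)) [∀ n, Injective (I.obj.X n)] :
    (rHomRing f).obj (DerivedCategory.Plus.Q.obj I) ≅
      DerivedCategory.Plus.Q.obj (coextendPlus f I) :=
  have : IsIso ((ModuleCat.coextendScalars.{u, u, u} f).rightDerivedFunctorPlusUnit.app
    ((HomotopyCategory.Plus.quotient _).obj I)) := inferInstance
  (@asIso _ _ _ _ ((ModuleCat.coextendScalars.{u, u, u} f).rightDerivedFunctorPlusUnit.app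
    ((HomotopyCategory.Plus.quotient _).obj I)) this).symm

omit [HasDerivedCategory.{w} (ModuleCat.{u} A)] in
lemma isDualizing_Q_obj_coextendPlus [IsNoetherianRing A] (hf : f.Finite)
    (I : CochainComplex.Plus (ModuleCat.{u} A)) [∀ n, Injective (I.obj.X n)] (a b : ℤ)
    [I.obj.IsStrictlyGE a] [I.obj.IsStrictlyLE b]
    (hI : ∀ n, Module.Finite A (I.obj.homology n))
    (hθ : QuasiIso (scalarsToEnd I.obj)) :
    IsDualizing (DerivedCategory.Plus.Q.obj (coextendPlus f I)) where
  isBoundedFinite := by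
    have : (coextendPlus f I).obj.IsStrictlyGE a :=
      inferInstanceAs ((coextendComplex f I.obj).IsStrictlyGE a)
    have : (coextendPlus f I).obj.IsStrictlyLE b :=
      inferInstanceAs ((coextendComplex f I.obj).IsStrictlyLE b)
    exact (isBoundedFinite_Q_obj (coextendPlus f I).obj a b
      fun n => finite_homology_of_restrictComplex f
        (finite_homology_restrictComplex_coextendComplex f hf I.obj a hI n)).of_iso
          (plusQObjIso _).symm
  hasFiniteInjectiveDimension := by
    have : (coextendPlus f I).obj.IsStrictlyLE b :=
      inferInstanceAs ((coextendComplex f I.obj).IsStrictlyLE b)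
    exact hasFiniteInjectiveDimension_Q_obj (coextendPlus f I) b
  isIso_theta := by
    refine ⟨coextendPlus f I, ⟨Iso.refl _⟩, ?_⟩
    have : Module.Finite A (restrictSelf f) := hf
    rw [isIso_theta_iff]
    exact quasiIso_scalarsToEnd_coextendComplex f I.obj
      (quasiIso_toBidual a b (restrictSelf f))

lemma isBoundedFinite_restrictScalarsDerived_coextendPlus [IsNoetherianRing A] (hf : f.Finite)
    (I : CochainComplex.Plus (ModuleCat.{u} A)) [∀ n, Injective (I.obj.X n)] (a b : ℤ)
    [I.obj.IsStrictlyGE a] [I.obj.IsStrictlyLE b]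
    (hI : ∀ n, Module.Finite A (I.obj.homology n)) :
    IsBoundedFinite ((restrictScalarsDerived f).obj
      (DerivedCategory.Plus.ι.obj (DerivedCategory.Plus.Q.obj (coextendPlus f I)))) :=
  (isBoundedFinite_Q_obj (restrictComplex f (coextendComplex f I.obj)) a b
    (finite_homology_restrictComplex_coextendComplex f hf I.obj a hI)).of_iso
      (((ModuleCat.restrictScalars.{u, u, u} f).mapDerivedCategoryFactors.app
        (coextendPlus f I).obj).symm ≪≫
          (restrictScalarsDerived f).mapIso (plusQObjIso (coextendPlus f I)).symm)

end RHomChangeOfRings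

end

end DualizingComplex

theorem mainTheorem11 {A B : Type u} [CommRing A] [CommRing B] [IsNoetherianRing A]
    [HasDerivedCategory.{w} (ModuleCat.{u} A)] [HasDerivedCategory.{w'} (ModuleCat.{u} B)]
    (f : A →+* B) (hf : f.Finite)
    (R : DerivedCategory.Plus (ModuleCat.{u} A)) (hR : DualizingComplex.IsDualizing R) :
    DualizingComplex.IsDualizing ((DualizingComplex.rHomRing f).obj R) ∧
      DualizingComplex.IsBoundedFinite ((DualizingComplex.restrictScalarsDerived f).obj
        (DerivedCategory.Plus.ι.obj ((DualizingComplex.rHomRing f).obj R))) := by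
  obtain ⟨T, hT, ⟨b, hb⟩, ⟨e⟩, hθ⟩ := hR.exists_bounded_injective
  obtain ⟨a, ha⟩ := T.property
  have hfin := (hR.isBoundedFinite.of_iso (DerivedCategory.Plus.ι.mapIso e.symm ≪≫
    DualizingComplex.plusQObjIso T)).finite_homology
  let e' := (DualizingComplex.rHomRingIso f T).symm ≪≫ (DualizingComplex.rHomRing f).mapIso e
  exact ⟨(DualizingComplex.isDualizing_Q_obj_coextendPlus f hf T a b hfin hθ).of_iso e',
    (DualizingComplex.isBoundedFinite_restrictScalarsDerived_coextendPlus f hf T a b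
      hfin).of_iso ((DualizingComplex.restrictScalarsDerived f).mapIso
        (DerivedCategory.Plus.ι.mapIso e'))⟩
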